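/- Let $\mathbb{D}=\{z\in\mathbb{C}:|z|<1\}$. Let $\{\alpha_n\}_{n=0}^{\infty}$ be a sequence of complex numbers and $N\ge 0$ an integer such that $|\alpha_n|\neq 1$ for $0\le n<N$ and $|\alpha_n|<1$ for $n\ge N$. Let $\{\Phi_n\}_{n\ge 0}$ be the monic polynomials generated by $$\Phi_0(z)=1,\qquad \Phi_{n+1}(z)=z\Phi_n(z)-\overline{\alpha_n}\,\Phi_n^*(z),\qquad \Phi_n^*(z)=z^n\overline{\Phi_n(1/\overline{z})},$$ and let $\{\Psi_n\}_{n\ge 0}$, with $\Psi_n^*(z)=z^n\overline{\Psi_n(1/\overline z)}$, be the polynomials generated in the same way by $\{-\alpha_n\}_{n\ge 0}$. Let $f_N:\mathbb{D}\to\overline{\mathbb{D}}$ be the Schur function with Schur parameters $\alpha_N,\alpha_{N+1},\dots$, that is, the first term of the unique sequence of analytic functions $f_n:\mathbb{D}\to\overline{\mathbb{D}}$, $n\ge N$, with $$f_n(z)=\frac{\alpha_n+zf_{n+1}(z)}{1+\overline{\alpha_n}\,zf_{n+1}(z)},\qquad n\ge N,\ z\in\mathbb{D}.$$ Let $$F(z)=\frac{\Psi_N^*(z)+z\Psi_N(z)f_N(z)}{\Phi_N^*(z)-z\Phi_N(z)f_N(z)},$$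 a meromorphic function on $\mathbb{D}$. Then $F$ has only finitely many poles in $\mathbb{D}$; let $\lambda_0,\dots,\lambda_m$ be these poles, each listed as often as its multiplicity (so $m+1$ is their number, which may be $0$). All zeros and poles below are counted with multiplicity. (i) Let $U$ be an open set contained in some compact set $K\subset\mathbb{D}$, and let $j$ be the number of poles of $F$ in $U$. Then for all sufficiently large $n$ the set $U$ contains at least $j$ zeros of $\Phi_n^*$; if moreover no pole of $F$ lies on the boundary of $U$, then for all sufficiently large $n$ the set $U$ contains exactly $j$ zeros of $\Phi_n^*$. (ii) If $K\subset\mathbb{D}$ is compact, then $K$ contains at most $m+1$ zeros of $\Phi_n^*$ for all sufficiently large $n$. -/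

import Mathlib

open Filter Topology Polynomial

/-- The open unit disk. -/
def unitDisk : Set ℂ := Metric.ball 0 1

/-- The reversed polynomial of degree `n`, that is `z ^ n * conj (p (1 / conj z))`. -/
noncomputable def starPoly (n : ℕ) (p : ℂ[X]) : ℂ[X] :=
  (p.map (starRingEnd ℂ)).reflect n

/-- The monic polynomials generated by the Szegő recurrence with coefficients `α`. -/
noncomputable def szegoPhi (α : ℕ → ℂ) : ℕ → ℂ[X]
  | 0 => 1
  | n + 1 => X * szegoPhi α n - C (starRingEnd ℂ (α n)) * starPoly n (szegoPhi α n)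

/-- The reversed polynomials of the `szegoPhi α n`. -/
noncomputable def szegoPhiStar (α : ℕ → ℂ) (n : ℕ) : ℂ[X] :=
  starPoly n (szegoPhi α n)

/-- The second kind polynomials: the Szegő recurrence with the coefficients `-α n`. -/
noncomputable def szegoPsi (α : ℕ → ℂ) (n : ℕ) : ℂ[X] :=
  szegoPhi (fun k => -α k) n

/-- The reversed second kind polynomials. -/
noncomputable def szegoPsiStar (α : ℕ → ℂ) (n : ℕ) : ℂ[X] :=
  starPoly n (szegoPsi α n)

/-- Schur functions: analytic functions from the unit disk to its closure. -/
def IsSchurFunction (f : ℂ → ℂ) : Prop :=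
  DifferentiableOn ℂ f unitDisk ∧ ∀ z ∈ unitDisk, ‖f z‖ ≤ 1

/-- One step `w ↦ (c + z w) / (1 + conj c * z w)` of the inverse Schur algorithm. -/
noncomputable def schurStep (c z w : ℂ) : ℂ :=
  (c + z * w) / (1 + starRingEnd ℂ c * (z * w))

/-- `f` is a Schur function with Schur parameters `γ`: the Schur algorithm started at `f`
runs through Schur functions `f = g 0, g 1, g 2, …` with parameters `γ 0, γ 1, γ 2, …`. -/
def HasSchurParameters (f : ℂ → ℂ) (γ : ℕ → ℂ) : Prop :=
  ∃ g : ℕ → ℂ → ℂ, g 0 = f ∧ (∀ n, IsSchurFunction (g n)) ∧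
    ∀ n, ∀ z ∈ unitDisk, g n z = schurStep (γ n) z (g (n + 1) z)

/-- The Schur function with Schur parameters `γ`. For `‖γ n‖ < 1` it exists and is unique on
the unit disk, see `schurFunction_spec` and `HasSchurParameters.unique` below. -/
noncomputable def schurFunction (γ : ℕ → ℂ) : ℂ → ℂ :=
  Classical.epsilon fun f => HasSchurParameters f γ

/-- The function `F` associated with the coefficients `α` and the index `N`. -/
noncomputable def pseudoCaratheodory (α : ℕ → ℂ) (N : ℕ) (z : ℂ) : ℂ :=
  ((szegoPsiStar α N).eval z
      + z * (szegoPsi α N).eval z * schurFunction (fun k => α (N + k)) z) /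
    ((szegoPhiStar α N).eval z
      - z * (szegoPhi α N).eval z * schurFunction (fun k => α (N + k)) z)

/-- The multiplicity of `z` as a pole of `F` (zero if `z` is not a pole). -/
noncomputable def poleMultiplicity (F : ℂ → ℂ) (z : ℂ) : ℕ :=
  (-(meromorphicOrderAt F z).untop₀).toNat

/-- `Λ` lists the poles of `F` in `S`, each as often as its multiplicity. -/
def IsPoleMultiset (F : ℂ → ℂ) (S : Set ℂ) (Λ : Multiset ℂ) : Prop :=
  (∀ z ∈ S, Λ.count z = poleMultiplicity F z) ∧ ∀ z ∈ Λ, z ∈ S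

open Classical in
/-- The number of members of `s` that lie in `S`, counted with multiplicity. -/
noncomputable def countIn (s : Multiset ℂ) (S : Set ℂ) : ℕ :=
  (s.filter (· ∈ S)).card

section SchurExistence

theorem schurStep_denom_ne {c v : ℂ} (hc : ‖c‖ < 1) (hv : ‖v‖ ≤ 1) :
    1 + starRingEnd ℂ c * v ≠ 0 := by
  intro h
  have h1 : starRingEnd ℂ c * v = -1 := by linear_combination h
  have h2 : ‖c‖ * ‖v‖ = 1 := by
    have := congrArg norm h1
    simpa using this
  nlinarith [norm_nonneg c, norm_nonneg v]

theorem norm_le_one_of_normSq {w : ℂ} : ‖w‖ ≤ 1 ↔ w.re * w.re + w.im * w.im ≤ 1 := by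
  rw [← Complex.normSq_apply, Complex.normSq_eq_norm_sq]
  constructor
  · intro h
    nlinarith [norm_nonneg w]
  · intro h
    nlinarith [norm_nonneg w]

theorem norm_le_norm_iff_normSq {w v : ℂ} :
    ‖w‖ ≤ ‖v‖ ↔ w.re * w.re + w.im * w.im ≤ v.re * v.re + v.im * v.im := by
  rw [← Complex.normSq_apply, ← Complex.normSq_apply, Complex.normSq_eq_norm_sq,
    Complex.normSq_eq_norm_sq]
  exact (sq_le_sq₀ (norm_nonneg _) (norm_nonneg _)).symm

theorem norm_sub_le_pseudo {w v : ℂ} (hw : ‖w‖ ≤ 1) (hv : ‖v‖ ≤ 1) :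
    ‖w - v‖ ≤ ‖1 - starRingEnd ℂ w * v‖ := by
  rw [norm_le_norm_iff_normSq]
  rw [norm_le_one_of_normSq] at hw hv
  simp
  nlinarith [mul_nonneg (sub_nonneg.2 hw) (sub_nonneg.2 hv)]

theorem norm_schurStep_le {c z w : ℂ} (hc : ‖c‖ < 1) (hz : ‖z‖ ≤ 1) (hw : ‖w‖ ≤ 1) :
    ‖schurStep c z w‖ ≤ 1 := by
  have hv : ‖z * w‖ ≤ 1 := by
    rw [norm_mul]
    exact mul_le_one₀ hz (norm_nonneg _) hw
  have hd := schurStep_denom_ne hc hv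
  unfold schurStep
  rw [norm_div, div_le_one (norm_pos_iff.2 hd)]
  have := norm_sub_le_pseudo hc.le (v := -(z * w)) (by rwa [norm_neg])
  simpa [sub_eq_add_neg] using this

/-- Each step contracts the pseudo-hyperbolic distance. -/
theorem schurStep_contract {c z w v : ℂ} {r q : ℝ} (hc : ‖c‖ < 1) (hzr : ‖z‖ ≤ r) (hr : r < 1)
    (hw : ‖w‖ ≤ 1) (hv : ‖v‖ ≤ 1) (hq : 0 ≤ q)
    (h : ‖w - v‖ ≤ q * ‖1 - starRingEnd ℂ w * v‖) :
    ‖schurStep c z w - schurStep c z v‖ ≤ (2 * r / (1 + r ^ 2) * q) *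
      ‖1 - starRingEnd ℂ (schurStep c z w) * schurStep c z v‖ := by
  have hz0 := norm_nonneg z
  have hz1 : ‖z‖ ≤ 1 := by linarith
  have hzw : ‖z * w‖ ≤ 1 := by
    rw [norm_mul]
    exact mul_le_one₀ hz1 (norm_nonneg _) hw
  have hzv : ‖z * v‖ ≤ 1 := by
    rw [norm_mul]
    exact mul_le_one₀ hz1 (norm_nonneg _) hv
  have hdw := schurStep_denom_ne hc hzw
  have hdv := schurStep_denom_ne hc hzv
  have hdw' : 1 + c * starRingEnd ℂ (z * w) ≠ 0 := by
    intro h0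
    apply hdw
    have := congrArg (starRingEnd ℂ) h0
    simpa using this
  have e1 : schurStep c z w - schurStep c z v =
      (1 - starRingEnd ℂ c * c) * (z * (w - v)) /
        ((1 + starRingEnd ℂ c * (z * w)) * (1 + starRingEnd ℂ c * (z * v))) := by
    unfold schurStep
    rw [div_sub_div _ _ hdw hdv]
    congr 1
    ring
  have e2 : 1 - starRingEnd ℂ (schurStep c z w) * schurStep c z v =
      (1 - starRingEnd ℂ c * c) * (1 - starRingEnd ℂ (z * w) * (z * v)) /
        ((1 + c * starRingEnd ℂ (z * w)) * (1 + starRingEnd ℂ c * (z * v))) := by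
    unfold schurStep
    rw [map_div₀, map_add, map_add, map_mul (starRingEnd ℂ) (starRingEnd ℂ c) (z * w), map_one,
      Complex.conj_conj, div_mul_div_comm, eq_div_iff (mul_ne_zero hdw' hdv), sub_mul,
      div_mul_cancel₀ _ (mul_ne_zero hdw' hdv), map_mul]
    ring
  have e3 : ‖1 + c * starRingEnd ℂ (z * w)‖ = ‖1 + starRingEnd ℂ c * (z * w)‖ := by
    rw [← Complex.norm_conj]
    simp
  have key : ‖z‖ * ‖1 - starRingEnd ℂ w * v‖ ≤
      2 * r / (1 + r ^ 2) * ‖1 - starRingEnd ℂ (z * w) * (z * v)‖ := by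
    set u := starRingEnd ℂ w * v with hu
    have hu1 : ‖u‖ ≤ 1 := by
      rw [hu, norm_mul, Complex.norm_conj]
      exact mul_le_one₀ hw (norm_nonneg _) hv
    have hzz : starRingEnd ℂ (z * w) * (z * v) = ((‖z‖ ^ 2 : ℝ) : ℂ) * u := by
      have : starRingEnd ℂ z * z = ((‖z‖ ^ 2 : ℝ) : ℂ) := by
        rw [mul_comm, Complex.mul_conj, Complex.normSq_eq_norm_sq]
      rw [← this, map_mul, hu]
      ring
    rw [hzz]
    set s := ‖z‖ with hs
    have h1 : (1 + s ^ 2) * ‖1 - u‖ ≤ 2 * ‖1 - ((s ^ 2 : ℝ) : ℂ) * u‖ := by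
      have a1 : (1 + s ^ 2) * ‖1 - u‖ = ‖((1 + s ^ 2 : ℝ) : ℂ) * (1 - u)‖ := by
        rw [norm_mul, Complex.norm_real, Real.norm_of_nonneg (by positivity)]
      have a2 : 2 * ‖1 - ((s ^ 2 : ℝ) : ℂ) * u‖ = ‖((2 : ℝ) : ℂ) * (1 - ((s ^ 2 : ℝ) : ℂ) * u)‖ := by
        rw [norm_mul, Complex.norm_real, Real.norm_of_nonneg (by positivity)]
      rw [a1, a2]
      have a3 : ((1 + s ^ 2 : ℝ) : ℂ) * (1 - u) =
          (1 - ((s ^ 2 : ℝ) : ℂ) * u) - (u - ((s ^ 2 : ℝ) : ℂ)) := by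
        push_cast
        ring
      have a4 : ‖u - ((s ^ 2 : ℝ) : ℂ)‖ ≤ ‖1 - ((s ^ 2 : ℝ) : ℂ) * u‖ := by
        have hs2 : ‖((s ^ 2 : ℝ) : ℂ)‖ ≤ 1 := by
          rw [Complex.norm_real, Real.norm_of_nonneg (by positivity)]
          exact pow_le_one₀ hz0 hz1
        have := norm_sub_le_pseudo hs2 hu1
        rw [norm_sub_rev] at this
        simpa only [Complex.conj_ofReal] using this
      rw [a3]
      calc _ ≤ ‖1 - ((s ^ 2 : ℝ) : ℂ) * u‖ + ‖u - ((s ^ 2 : ℝ) : ℂ)‖ := norm_sub_le _ _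
        _ ≤ 2 * ‖1 - ((s ^ 2 : ℝ) : ℂ) * u‖ := by linarith
        _ = _ := by rw [norm_mul, Complex.norm_real, Real.norm_of_nonneg (by norm_num)]
    have h2 : s / (1 + s ^ 2) ≤ r / (1 + r ^ 2) := by
      rw [div_le_div_iff₀ (by positivity) (by positivity)]
      nlinarith [mul_nonneg (sub_nonneg.2 hzr) (sub_nonneg.2 (mul_le_one₀ hz1 (hz0.trans hzr) hr.le))]
    calc s * ‖1 - u‖ = s / (1 + s ^ 2) * ((1 + s ^ 2) * ‖1 - u‖) := by
          field_simp
      _ ≤ r / (1 + r ^ 2) * (2 * ‖1 - ((s ^ 2 : ℝ) : ℂ) * u‖) := by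
          apply mul_le_mul h2 h1 (by positivity)
          exact div_nonneg (hz0.trans hzr) (by positivity)
      _ = _ := by ring
  rw [e1, e2, norm_div, norm_div, norm_mul, norm_mul, norm_mul, norm_mul, norm_mul, e3,
    ← mul_div_assoc]
  apply div_le_div_of_nonneg_right _ (by positivity)
  have h5 : ‖z‖ * ‖w - v‖ ≤ (2 * r / (1 + r ^ 2) * q) * ‖1 - starRingEnd ℂ (z * w) * (z * v)‖ := by
    calc ‖z‖ * ‖w - v‖ ≤ ‖z‖ * (q * ‖1 - starRingEnd ℂ w * v‖) := by gcongr
      _ = q * (‖z‖ * ‖1 - starRingEnd ℂ w * v‖) := by ring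
      _ ≤ q * (2 * r / (1 + r ^ 2) * ‖1 - starRingEnd ℂ (z * w) * (z * v)‖) := by gcongr
      _ = _ := by ring
  calc _ ≤ ‖1 - starRingEnd ℂ c * c‖ *
        ((2 * r / (1 + r ^ 2) * q) * ‖1 - starRingEnd ℂ (z * w) * (z * v)‖) := by gcongr
    _ = _ := by ring

/-- The Schur approximants: `n` steps of the inverse Schur algorithm, started at zero. -/
noncomputable def schurApprox : ℕ → (ℕ → ℂ) → ℂ → ℂ
  | 0, _, _ => 0
  | n + 1, γ, z => schurStep (γ 0) z (schurApprox n (fun k => γ (k + 1)) z)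

theorem schurApprox_norm_le (n : ℕ) {γ : ℕ → ℂ} (hγ : ∀ k, ‖γ k‖ < 1) {z : ℂ} (hz : ‖z‖ ≤ 1) :
    ‖schurApprox n γ z‖ ≤ 1 := by
  induction n generalizing γ with
  | zero => simp [schurApprox]
  | succ n ih => exact norm_schurStep_le (hγ 0) hz (ih fun k => hγ (k + 1))

theorem schurApprox_differentiableOn (n : ℕ) {γ : ℕ → ℂ} (hγ : ∀ k, ‖γ k‖ < 1) :
    DifferentiableOn ℂ (schurApprox n γ) unitDisk := by
  induction n generalizing γ with
  | zero => exact differentiableOn_const _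
  | succ n ih =>
    have h := ih (γ := fun k => γ (k + 1)) fun k => hγ (k + 1)
    refine DifferentiableOn.div (by fun_prop) (by fun_prop) fun z hz => ?_
    have hz1 : ‖z‖ ≤ 1 := (mem_ball_zero_iff.1 hz).le
    apply schurStep_denom_ne (hγ 0)
    rw [norm_mul]
    exact mul_le_one₀ hz1 (norm_nonneg _) (schurApprox_norm_le n (fun k => hγ (k + 1)) hz1)

/-- Two sequences that follow the Schur algorithm for `n` steps have close initial terms. -/
theorem schur_close {z : ℂ} {r : ℝ} (hzr : ‖z‖ ≤ r) (hr : r < 1) (n : ℕ) :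
    ∀ {γ : ℕ → ℂ} (_ : ∀ k, ‖γ k‖ < 1) (a b : ℕ → ℂ) (_ : ∀ k, ‖a k‖ ≤ 1) (_ : ∀ k, ‖b k‖ ≤ 1)
      (_ : ∀ k < n, a k = schurStep (γ k) z (a (k + 1)))
      (_ : ∀ k < n, b k = schurStep (γ k) z (b (k + 1))),
      ‖a 0 - b 0‖ ≤ (2 * r / (1 + r ^ 2)) ^ n * ‖1 - starRingEnd ℂ (a 0) * b 0‖ := by
  have hr0 : 0 ≤ r := (norm_nonneg z).trans hzr
  induction n with
  | zero =>
    intro γ _ a b ha hb _ _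
    simpa using norm_sub_le_pseudo (ha 0) (hb 0)
  | succ n ih =>
    intro γ hγ a b ha hb ha' hb'
    have h := ih (γ := fun k => γ (k + 1)) (fun k => hγ (k + 1)) (fun k => a (k + 1))
      (fun k => b (k + 1)) (fun k => ha _) (fun k => hb _)
      (fun k hk => ha' (k + 1) (by omega)) (fun k hk => hb' (k + 1) (by omega))
    have h2 := schurStep_contract (hγ 0) hzr hr (ha 1) (hb 1) (by positivity) h
    rw [ha' 0 (by omega), hb' 0 (by omega), pow_succ']
    exact h2

theorem schur_close' {z : ℂ} {r : ℝ} (hzr : ‖z‖ ≤ r) (hr : r < 1) (n : ℕ)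
    {γ : ℕ → ℂ} (hγ : ∀ k, ‖γ k‖ < 1) (a b : ℕ → ℂ) (ha : ∀ k, ‖a k‖ ≤ 1) (hb : ∀ k, ‖b k‖ ≤ 1)
    (ha' : ∀ k < n, a k = schurStep (γ k) z (a (k + 1)))
    (hb' : ∀ k < n, b k = schurStep (γ k) z (b (k + 1))) :
    ‖a 0 - b 0‖ ≤ 2 * (2 * r / (1 + r ^ 2)) ^ n := by
  have hr0 : 0 ≤ r := (norm_nonneg z).trans hzr
  have h := schur_close hzr hr n hγ a b ha hb ha' hb'
  have h1 : ‖1 - starRingEnd ℂ (a 0) * b 0‖ ≤ 2 := by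
    calc _ ≤ ‖(1 : ℂ)‖ + ‖starRingEnd ℂ (a 0) * b 0‖ := norm_sub_le _ _
      _ ≤ 1 + 1 := by
        rw [norm_one, norm_mul, Complex.norm_conj]
        gcongr
        exact mul_le_one₀ (ha 0) (norm_nonneg _) (hb 0)
      _ = 2 := by norm_num
  have h2 : 0 ≤ (2 * r / (1 + r ^ 2)) ^ n := by positivity
  nlinarith

theorem schurRate_lt_one {r : ℝ} (hr : r < 1) : 2 * r / (1 + r ^ 2) < 1 := by
  rw [div_lt_one (by positivity)]
  nlinarith [mul_pos (sub_pos.2 hr) (sub_pos.2 hr)]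

theorem schurApprox_close {z : ℂ} {r : ℝ} (hzr : ‖z‖ ≤ r) (hr : r < 1) {n m l : ℕ}
    (hm : n ≤ m) (hl : n ≤ l) {γ : ℕ → ℂ} (hγ : ∀ k, ‖γ k‖ < 1) :
    ‖schurApprox m γ z - schurApprox l γ z‖ ≤ 2 * (2 * r / (1 + r ^ 2)) ^ n := by
  have hz1 : ‖z‖ ≤ 1 := by linarith
  have step : ∀ m, n ≤ m → ∀ k < n, schurApprox (m - k) (fun i => γ (i + k)) z =
      schurStep (γ k) z (schurApprox (m - (k + 1)) (fun i => γ (i + (k + 1))) z) := by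
    intro m hm k hk
    obtain ⟨j, hj⟩ : ∃ j, m - k = j + 1 := ⟨m - k - 1, by omega⟩
    have hj' : m - (k + 1) = j := by omega
    rw [hj, hj', schurApprox]
    simp only [zero_add, add_right_comm, add_assoc]
  exact schur_close' hzr hr n hγ (fun k => schurApprox (m - k) (fun i => γ (i + k)) z)
    (fun k => schurApprox (l - k) (fun i => γ (i + k)) z)
    (fun k => schurApprox_norm_le _ (fun _ => hγ _) hz1)
    (fun k => schurApprox_norm_le _ (fun _ => hγ _) hz1) (step m hm) (step l hl)

theorem schurApprox_tendsto {γ : ℕ → ℂ} (hγ : ∀ k, ‖γ k‖ < 1) :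
    ∃ f : ℂ → ℂ, IsSchurFunction f ∧
      ∀ z ∈ unitDisk, Tendsto (fun n => schurApprox n γ z) atTop (𝓝 (f z)) := by
  have hrate : ∀ r : ℝ, 0 ≤ r → r < 1 →
      Tendsto (fun n : ℕ => 2 * (2 * r / (1 + r ^ 2)) ^ n) atTop (𝓝 0) := by
    intro r hr0 hr
    simpa using (tendsto_pow_atTop_nhds_zero_of_lt_one (by positivity)
      (schurRate_lt_one hr)).const_mul 2
  have hlim : ∀ z : ℂ, ∃ w, z ∈ unitDisk → Tendsto (fun n => schurApprox n γ z) atTop (𝓝 w) := by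
    intro z
    by_cases hz : z ∈ unitDisk
    · have hz1 : ‖z‖ < 1 := mem_ball_zero_iff.1 hz
      have hc : CauchySeq fun n => schurApprox n γ z :=
        cauchySeq_of_le_tendsto_0 _ (fun n m k hn hm => by
          rw [dist_eq_norm]
          exact schurApprox_close le_rfl hz1 hn hm hγ) (hrate _ (norm_nonneg z) hz1)
      obtain ⟨w, hw⟩ := cauchySeq_tendsto_of_complete hc
      exact ⟨w, fun _ => hw⟩
    · exact ⟨0, fun h => absurd h hz⟩
  choose f hf using hlim
  refine ⟨f, ⟨?_, fun z hz => ?_⟩, hf⟩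
  · have ho : IsOpen unitDisk := Metric.isOpen_ball
    have hloc : TendstoLocallyUniformlyOn (fun n => schurApprox n γ) f atTop unitDisk := by
      rw [tendstoLocallyUniformlyOn_iff_forall_isCompact ho]
      intro K hK hKc
      obtain ⟨r, hr0, hr, hKr⟩ : ∃ r : ℝ, 0 ≤ r ∧ r < 1 ∧ ∀ z ∈ K, ‖z‖ ≤ r := by
        rcases K.eq_empty_or_nonempty with rfl | hne
        · exact ⟨0, le_rfl, one_pos, by simp⟩
        · obtain ⟨x, hx, hmax⟩ := hKc.exists_isMaxOn hne continuous_norm.continuousOn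
          exact ⟨‖x‖, norm_nonneg x, mem_ball_zero_iff.1 (hK hx), fun z hz => hmax hz⟩
      rw [Metric.tendstoUniformlyOn_iff]
      intro ε hε
      filter_upwards [(hrate r hr0 hr).eventually (gt_mem_nhds hε)] with n hn z hz
      refine lt_of_le_of_lt ?_ hn
      have ht : Tendsto (fun m => dist (schurApprox m γ z) (schurApprox n γ z)) atTop
          (𝓝 (dist (f z) (schurApprox n γ z))) := (hf z (hK hz)).dist tendsto_const_nhds
      refine le_of_tendsto ht ?_
      filter_upwards [eventually_ge_atTop n] with m hm
      rw [dist_eq_norm]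
      exact schurApprox_close (hKr z hz) hr hm le_rfl hγ
    exact hloc.differentiableOn
      (Eventually.of_forall fun n => schurApprox_differentiableOn n hγ) ho
  · exact le_of_tendsto (hf z hz).norm (Eventually.of_forall fun n =>
      schurApprox_norm_le n hγ (mem_ball_zero_iff.1 hz).le)

/-- Every sequence in the open unit disk is the sequence of Schur parameters of some `f`. -/
theorem exists_hasSchurParameters {γ : ℕ → ℂ} (hγ : ∀ k, ‖γ k‖ < 1) :
    ∃ f, HasSchurParameters f γ := by
  have h : ∀ n, ∃ f : ℂ → ℂ, IsSchurFunction f ∧ ∀ z ∈ unitDisk,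
      Tendsto (fun j => schurApprox j (fun k => γ (k + n)) z) atTop (𝓝 (f z)) :=
    fun n => schurApprox_tendsto fun k => hγ (k + n)
  choose g hg hlim using h
  refine ⟨g 0, g, rfl, hg, fun n z hz => ?_⟩
  have hz1 : ‖z‖ ≤ 1 := (mem_ball_zero_iff.1 hz).le
  have hd : 1 + starRingEnd ℂ (γ n) * (z * g (n + 1) z) ≠ 0 := by
    apply schurStep_denom_ne (hγ n)
    rw [norm_mul]
    exact mul_le_one₀ hz1 (norm_nonneg _) ((hg (n + 1)).2 z hz)
  have h1 := (tendsto_add_atTop_iff_nat 1).2 (hlim n z hz)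
  have h2 : Tendsto (fun j => schurStep (γ n) z (schurApprox j (fun k => γ (k + (n + 1))) z)) atTop
      (𝓝 (schurStep (γ n) z (g (n + 1) z))) := by
    have h3 := (hlim (n + 1) z hz).const_mul z
    exact (h3.const_add (γ n)).div ((h3.const_mul (starRingEnd ℂ (γ n))).const_add 1) hd
  refine tendsto_nhds_unique h1 (h2.congr fun j => ?_)
  simp only [schurApprox, zero_add, add_right_comm, add_assoc]

/-- A Schur function is determined on the unit disk by its Schur parameters. -/
theorem HasSchurParameters.unique {γ : ℕ → ℂ} (hγ : ∀ k, ‖γ k‖ < 1) {f₁ f₂ : ℂ → ℂ}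
    (h₁ : HasSchurParameters f₁ γ) (h₂ : HasSchurParameters f₂ γ) : Set.EqOn f₁ f₂ unitDisk := by
  obtain ⟨a, rfl, ha, ha'⟩ := h₁
  obtain ⟨b, rfl, hb, hb'⟩ := h₂
  intro z hz
  have hz1 : ‖z‖ < 1 := mem_ball_zero_iff.1 hz
  have ht : Tendsto (fun n : ℕ => 2 * (2 * ‖z‖ / (1 + ‖z‖ ^ 2)) ^ n) atTop (𝓝 0) := by
    simpa using (tendsto_pow_atTop_nhds_zero_of_lt_one (by positivity)
      (schurRate_lt_one hz1)).const_mul 2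
  have hle : ‖a 0 z - b 0 z‖ ≤ 0 := ge_of_tendsto' ht fun n =>
    schur_close' le_rfl hz1 n hγ (fun k => a k z) (fun k => b k z)
      (fun k => (ha k).2 z hz) (fun k => (hb k).2 z hz)
      (fun k _ => ha' k z hz) (fun k _ => hb' k z hz)
  exact sub_eq_zero.1 (norm_le_zero_iff.1 hle)

theorem schurFunction_spec {γ : ℕ → ℂ} (hγ : ∀ k, ‖γ k‖ < 1) :
    HasSchurParameters (schurFunction γ) γ :=
  Classical.epsilon_spec (exists_hasSchurParameters hγ)

end SchurExistence

/-! Let `D = Φ_N^* - z Φ_N f_N` be the denominator of `F`. A Wronskian identity shows that numerator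
and denominator have no common zero in the disk, so the poles of `F` are the zeros of `D`, with the
same multiplicities (`poleMultiplicity_pseudoCaratheodory`).

If `f_N` is replaced by its `m`-th Schur approximant, `D` becomes `Φ_{N+m}^*` up to a factor without
zeros (`szegoPhiStar_eq_mul_szegoDenom`). The approximants converge to `f_N` uniformly on compact
sets, so Hurwitz's theorem, obtained here from Rouché's, carries zeros of `D` to zeros of `Φ_n^*`
for large `n`, and conversely on compact sets.

Finiteness: on the unit circle `|Φ_n^*| = |Φ_n|`, so for `n ≥ N` Rouché's theorem keeps the number
of zeros of `Φ_n^*` in the disk constant (`countIn_roots_szegoPhiStar_unitDisk`). That constant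
bounds the number of zeros of `D`. -/

/-! ### The recurrence for the reversed polynomials. -/

theorem szegoPhi_natDegree_le (α : ℕ → ℂ) (n : ℕ) : (szegoPhi α n).natDegree ≤ n := by
  induction n with
  | zero => simp [szegoPhi]
  | succ n ih =>
    have h1 : (starPoly n (szegoPhi α n)).natDegree ≤ n := by
      unfold starPoly
      exact (natDegree_reflect_le).trans (max_le le_rfl ((natDegree_map_le).trans ih))
    rw [szegoPhi]
    refine (natDegree_sub_le _ _).trans (max_le ?_ ?_)
    · exact (natDegree_mul_le).trans (by rw [natDegree_X]; omega)
    · exact (natDegree_C_mul_le _ _).trans (h1.trans n.le_succ)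

theorem szegoPhiStar_succ (α : ℕ → ℂ) (n : ℕ) :
    szegoPhiStar α (n + 1) = szegoPhiStar α n - C (α n) * (X * szegoPhi α n) := by
  have hd := szegoPhi_natDegree_le α n
  have h1 : ((szegoPhi α n).map (starRingEnd ℂ)).natDegree ≤ n := (natDegree_map_le).trans hd
  have h2 : ((szegoPhiStar α n).map (starRingEnd ℂ)) = reflect n (szegoPhi α n) := by
    unfold szegoPhiStar starPoly
    rw [← reflect_map, Polynomial.map_map]
    congr 1
    ext k
    simp
  have h3 := reflect_mul (f := (X : ℂ[X])) (g := (szegoPhi α n).map (starRingEnd ℂ))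
    (F := 1) (G := n) (by simp) h1
  -- The dummy factor `1`, reversed in degree 1, supplies the `X` gained when a polynomial of degree
  -- at most `n` is reversed in degree `n + 1`.
  have h4 := reflect_mul (f := (1 : ℂ[X])) (g := reflect n (szegoPhi α n))
    (F := 1) (G := n) (by simp) ((natDegree_reflect_le).trans (max_le le_rfl hd))
  have h5 : (szegoPhi α (n + 1)).map (starRingEnd ℂ) =
      X * (szegoPhi α n).map (starRingEnd ℂ) - C (α n) * reflect n (szegoPhi α n) := by
    rw [szegoPhi, Polynomial.map_sub, Polynomial.map_mul, Polynomial.map_mul, ← szegoPhiStar, h2]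
    simp
  have h6 : szegoPhiStar α (n + 1) =
      reflect (1 + n) ((szegoPhi α (n + 1)).map (starRingEnd ℂ)) := by
    rw [add_comm 1 n]; rfl
  rw [one_mul, reflect_reflect, reflect_one, pow_one] at h4
  rw [reflect_one_X, one_mul] at h3
  rw [h6, h5, reflect_sub, reflect_C_mul, h3, h4]
  rfl

/-! ### Pointwise recurrences, the Wronskian, and behaviour on the unit circle. -/

section Evaluation

variable (α : ℕ → ℂ) (n : ℕ) (z : ℂ)

theorem eval_szegoPhi_succ : (szegoPhi α (n + 1)).eval z =
    z * (szegoPhi α n).eval z - starRingEnd ℂ (α n) * (szegoPhiStar α n).eval z := by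
  rw [szegoPhi, ← szegoPhiStar]
  simp

theorem eval_szegoPhiStar_succ : (szegoPhiStar α (n + 1)).eval z =
    (szegoPhiStar α n).eval z - α n * (z * (szegoPhi α n).eval z) := by
  rw [szegoPhiStar_succ]
  simp

theorem eval_szegoPsi_succ : (szegoPsi α (n + 1)).eval z =
    z * (szegoPsi α n).eval z + starRingEnd ℂ (α n) * (szegoPsiStar α n).eval z := by
  have := eval_szegoPhi_succ (fun k => -α k) n z
  rw [map_neg, neg_mul, sub_neg_eq_add] at this
  exact this

theorem eval_szegoPsiStar_succ : (szegoPsiStar α (n + 1)).eval z =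
    (szegoPsiStar α n).eval z + α n * (z * (szegoPsi α n).eval z) := by
  have := eval_szegoPhiStar_succ (fun k => -α k) n z
  rw [neg_mul, sub_neg_eq_add] at this
  exact this

theorem eval_szegoPhiStar_zero : (szegoPhiStar α 0).eval z = 1 := by
  simp [szegoPhiStar, szegoPhi, starPoly]

theorem eval_szegoPhiStar_at_zero : (szegoPhiStar α n).eval 0 = 1 := by
  induction n with
  | zero => exact eval_szegoPhiStar_zero α 0
  | succ n ih => rw [eval_szegoPhiStar_succ, ih]; simp

/-- Each recurrence step multiplies the left side by the determinant `z (1 - |α n|^2)` of its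
transfer matrix, starting from `1 + 1 = 2`. The formula excludes common zeros away from the origin.
-/
theorem szego_wronskian : (szegoPhiStar α n).eval z * (szegoPsi α n).eval z +
      (szegoPhi α n).eval z * (szegoPsiStar α n).eval z =
    2 * z ^ n * ∏ k ∈ Finset.range n, (1 - α k * starRingEnd ℂ (α k)) := by
  induction n with
  | zero =>
    have h1 : (szegoPsiStar α 0).eval z = 1 := eval_szegoPhiStar_zero _ z
    rw [eval_szegoPhiStar_zero, h1]
    simp [szegoPsi, szegoPhi]
    norm_num
  | succ n ih =>
    rw [eval_szegoPhiStar_succ, eval_szegoPhi_succ, eval_szegoPsi_succ, eval_szegoPsiStar_succ,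
      Finset.prod_range_succ]
    linear_combination (z * (1 - α n * starRingEnd ℂ (α n))) * ih

theorem szegoPhiStar_ne_zero : szegoPhiStar α n ≠ 0 := by
  intro h
  have := eval_szegoPhiStar_at_zero α n
  simp [h] at this

variable {z} in
-- On the circle `1 / conj z = z`; the induction uses this in the form `z * conj z = 1`.
theorem eval_szegoPhiStar_of_norm_eq_one (hz : ‖z‖ = 1) :
    (szegoPhiStar α n).eval z = z ^ n * starRingEnd ℂ ((szegoPhi α n).eval z) := by
  have hzz : z * starRingEnd ℂ z = 1 := by
    rw [Complex.mul_conj, Complex.normSq_eq_norm_sq, hz]; simp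
  induction n with
  | zero => simp [eval_szegoPhiStar_zero, szegoPhi]
  | succ n ih =>
    have h : starRingEnd ℂ (z ^ n * starRingEnd ℂ ((szegoPhi α n).eval z)) * z ^ n =
        (szegoPhi α n).eval z := by
      rw [map_mul, map_pow, Complex.conj_conj, mul_right_comm, ← mul_pow, mul_comm _ z, hzz]
      simp
    rw [eval_szegoPhiStar_succ, eval_szegoPhi_succ, ih, map_sub, map_mul, map_mul, Complex.conj_conj]
    linear_combination (-z ^ n * starRingEnd ℂ ((szegoPhi α n).eval z)) * hzz + (α n * z) * h

variable {z} in
theorem norm_eval_szegoPhiStar_of_norm_eq_one (hz : ‖z‖ = 1) :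
    ‖(szegoPhiStar α n).eval z‖ = ‖(szegoPhi α n).eval z‖ := by
  rw [eval_szegoPhiStar_of_norm_eq_one α n hz]
  simp [hz]

variable {α} in
theorem szego_prod_ne_zero (h : ∀ k < n, ‖α k‖ ≠ 1) :
    ∏ k ∈ Finset.range n, (1 - α k * starRingEnd ℂ (α k)) ≠ 0 := by
  refine Finset.prod_ne_zero_iff.2 fun k hk h0 => h k (Finset.mem_range.1 hk) ?_
  rw [Complex.mul_conj, Complex.normSq_eq_norm_sq, sub_eq_zero] at h0
  have h1 : ‖α k‖ ^ 2 = 1 := by exact_mod_cast h0.symm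
  exact (pow_eq_one_iff_of_nonneg (norm_nonneg _) two_ne_zero).1 h1

variable {α z} in
-- On the circle `Φ_n` and `Φ_n^*` vanish together, and then the Wronskian would vanish too.
theorem eval_szegoPhiStar_ne_zero_of_norm_eq_one (h : ∀ k < n, ‖α k‖ ≠ 1) (hz : ‖z‖ = 1) :
    (szegoPhiStar α n).eval z ≠ 0 := by
  intro h0
  have h1 : (szegoPhi α n).eval z = 0 := by
    rw [← norm_eq_zero, ← norm_eval_szegoPhiStar_of_norm_eq_one α n hz, h0, norm_zero]
  have hw := szego_wronskian α n z
  rw [h0, h1] at hw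
  have hz0 : z ≠ 0 := by rintro rfl; simp at hz
  have := mul_ne_zero (mul_ne_zero two_ne_zero (pow_ne_zero n hz0)) (szego_prod_ne_zero n h)
  exact this (by rw [← hw]; ring)

end Evaluation

/-! ### The denominator of `F` and its approximation by the `Φ_n^*`. -/

/-- The denominator `Φ_N^* - z Φ_N f` that the coefficients before `N` associate with the Schur
function `f`. -/
noncomputable def szegoDenom (α : ℕ → ℂ) (N : ℕ) (f : ℂ → ℂ) (z : ℂ) : ℂ :=
  (szegoPhiStar α N).eval z - z * (szegoPhi α N).eval z * f z

/-- Replacing the tail of the Schur algorithm by zero turns the denominator into a multiple of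
`Φ_{N+m}^*` by a function without zeros. -/
theorem szegoPhiStar_eq_mul_szegoDenom {α : ℕ → ℂ} (m : ℕ) :
    ∀ {N : ℕ}, (∀ n, N ≤ n → ‖α n‖ < 1) → ∃ u : ℂ → ℂ, DifferentiableOn ℂ u unitDisk ∧
      (∀ z ∈ unitDisk, u z ≠ 0) ∧ ∀ z ∈ unitDisk, (szegoPhiStar α (N + m)).eval z =
        u z * szegoDenom α N (schurApprox m fun k => α (N + k)) z := by
  induction m with
  | zero =>
    intro N _
    exact ⟨fun _ => 1, differentiableOn_const _, fun _ _ => one_ne_zero, fun z _ => by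
      simp [szegoDenom, schurApprox]⟩
  | succ m ih =>
    intro N hN
    -- The induction peels the parameter `α N` off the front, hence the general `N`. Passing from `N
    -- + 1` back to `N` costs exactly the denominator of the Schur step, which has no zeros in the
    -- disk.
    obtain ⟨u, hu, hu0, hu1⟩ := ih (N := N + 1) fun n hn => hN n (by omega)
    have hγ : ∀ k, ‖α (N + 1 + k)‖ < 1 := fun k => hN _ (by omega)
    have hd : ∀ z ∈ unitDisk, 1 + starRingEnd ℂ (α N) *
        (z * schurApprox m (fun k => α (N + 1 + k)) z) ≠ 0 := by
      intro z hz
      have hz1 : ‖z‖ ≤ 1 := (mem_ball_zero_iff.1 hz).le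
      apply schurStep_denom_ne (hN N le_rfl)
      rw [norm_mul]
      exact mul_le_one₀ hz1 (norm_nonneg _) (schurApprox_norm_le m hγ hz1)
    have hf := schurApprox_differentiableOn m hγ
    refine ⟨fun z => u z * (1 + starRingEnd ℂ (α N) *
        (z * schurApprox m (fun k => α (N + 1 + k)) z)), hu.mul (by fun_prop),
      fun z hz => mul_ne_zero (hu0 z hz) (hd z hz), fun z hz => ?_⟩
    rw [show N + (m + 1) = N + 1 + m by omega, hu1 z hz, mul_assoc]
    congr 1
    have hγ' : (fun k => α (N + (k + 1))) = fun k => α (N + 1 + k) :=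
      funext fun k => congrArg α (by omega)
    have hd' := hd z hz
    rw [szegoDenom, szegoDenom, schurApprox, schurStep, hγ', add_zero, eval_szegoPhiStar_succ,
      eval_szegoPhi_succ]
    generalize schurApprox m (fun k => α (N + 1 + k)) z = w at *
    have hq := mul_div_cancel₀ (α N + z * w) hd'
    generalize (α N + z * w) / (1 + starRingEnd ℂ (α N) * (z * w)) = q at *
    linear_combination (z * (szegoPhi α N).eval z) * hq

theorem schurFunction_isSchurFunction {γ : ℕ → ℂ} (hγ : ∀ k, ‖γ k‖ < 1) :
    IsSchurFunction (schurFunction γ) := by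
  obtain ⟨g, h0, hg, -⟩ := schurFunction_spec hγ
  exact h0 ▸ hg 0

/-- The approximant and the limit follow the same first `n` Schur steps, each of which contracts the
pseudo-hyperbolic distance by `2r / (1 + r^2)`. -/
theorem norm_schurApprox_sub_schurFunction_le {γ : ℕ → ℂ} (hγ : ∀ k, ‖γ k‖ < 1) (n : ℕ) {r : ℝ}
    (hr : r < 1) {z : ℂ} (hz : ‖z‖ ≤ r) :
    ‖schurApprox n γ z - schurFunction γ z‖ ≤ 2 * (2 * r / (1 + r ^ 2)) ^ n := by
  obtain ⟨g, h0, hg, hg'⟩ := schurFunction_spec hγ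
  have hz1 : ‖z‖ < 1 := by linarith
  have hzD : z ∈ unitDisk := mem_ball_zero_iff.2 hz1
  -- For `k ≥ n` the truncated `n - k` makes the first sequence zero; there only the bound by 1 is
  -- needed.
  have := schur_close' hz hr n hγ (fun k => schurApprox (n - k) (fun i => γ (i + k)) z)
    (fun k => g k z) (fun k => schurApprox_norm_le _ (fun _ => hγ _) hz1.le)
    (fun k => (hg k).2 z hzD) ?_ fun k _ => hg' k z hzD
  · simpa only [tsub_zero, add_zero, h0] using this
  · intro k hk
    obtain ⟨j, hj⟩ : ∃ j, n - k = j + 1 := ⟨n - k - 1, by omega⟩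
    have hj' : n - (k + 1) = j := by omega
    simp only [hj, hj', schurApprox, zero_add, add_right_comm, add_assoc]

theorem exists_norm_le_of_isCompact_subset_unitDisk {K : Set ℂ} (hKc : IsCompact K)
    (hK : K ⊆ unitDisk) : ∃ r : ℝ, 0 ≤ r ∧ r < 1 ∧ ∀ z ∈ K, ‖z‖ ≤ r := by
  rcases K.eq_empty_or_nonempty with rfl | hne
  · exact ⟨0, le_rfl, one_pos, by simp⟩
  · obtain ⟨x, hx, hmax⟩ := hKc.exists_isMaxOn hne continuous_norm.continuousOn
    exact ⟨‖x‖, norm_nonneg x, mem_ball_zero_iff.1 (hK hx), fun z hz => hmax hz⟩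

theorem tendstoUniformlyOn_szegoDenom {α : ℕ → ℂ} {N : ℕ} (hlt : ∀ n, N ≤ n → ‖α n‖ < 1)
    {K : Set ℂ} (hKc : IsCompact K) (hK : K ⊆ unitDisk) :
    TendstoUniformlyOn (fun n => szegoDenom α N (schurApprox n fun k => α (N + k)))
      (szegoDenom α N (schurFunction fun k => α (N + k))) atTop K := by
  have hγ : ∀ k, ‖α (N + k)‖ < 1 := fun k => hlt _ (by omega)
  obtain ⟨r, hr0, hr, hKr⟩ := exists_norm_le_of_isCompact_subset_unitDisk hKc hK
  obtain ⟨M, hM⟩ := hKc.exists_bound_of_continuousOn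
    (f := fun z => z * (szegoPhi α N).eval z) (by fun_prop)
  have ht : Tendsto (fun n : ℕ => M * (2 * (2 * r / (1 + r ^ 2)) ^ n)) atTop (𝓝 0) := by
    simpa using ((tendsto_pow_atTop_nhds_zero_of_lt_one (by positivity)
      (schurRate_lt_one hr)).const_mul 2).const_mul M
  rw [Metric.tendstoUniformlyOn_iff]
  intro ε hε
  filter_upwards [ht.eventually (gt_mem_nhds hε)] with n hn z hz
  refine lt_of_le_of_lt ?_ hn
  rw [dist_eq_norm, szegoDenom, szegoDenom, sub_sub_sub_cancel_left, ← mul_sub, norm_mul]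
  exact mul_le_mul (hM z hz) (norm_schurApprox_sub_schurFunction_le hγ n hr (hKr z hz))
    (norm_nonneg _) ((norm_nonneg _).trans (hM z hz))

theorem szegoDenom_differentiableOn (α : ℕ → ℂ) (N : ℕ) {f : ℂ → ℂ}
    (hf : DifferentiableOn ℂ f unitDisk) : DifferentiableOn ℂ (szegoDenom α N f) unitDisk := by
  unfold szegoDenom
  fun_prop

theorem szegoDenom_zero (α : ℕ → ℂ) (N : ℕ) (f : ℂ → ℂ) : szegoDenom α N f 0 = 1 := by
  simp [szegoDenom, eval_szegoPhiStar_at_zero]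

/-! ### The argument principle and Rouché's theorem on a disk. -/

theorem circleIntegrable_logDeriv {c : ℂ} {R : ℝ} (hR : 0 ≤ R) {O : Set ℂ} (hO : IsOpen O)
    (hs : Metric.sphere c R ⊆ O) {f : ℂ → ℂ} (hf : DifferentiableOn ℂ f O)
    (h0 : ∀ z ∈ Metric.sphere c R, f z ≠ 0) : CircleIntegrable (logDeriv f) c R := by
  refine ContinuousOn.circleIntegrable hR ?_
  exact ((hf.deriv hO).continuousOn.mono hs).div (hf.continuousOn.mono hs) h0

theorem multiset_prod_sub_ne_zero {s : Multiset ℂ} {z : ℂ} (h : z ∉ s) :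
    (s.map (z - ·)).prod ≠ 0 := by
  intro h0
  obtain ⟨a, ha, hz⟩ := Multiset.mem_map.1 (Multiset.prod_eq_zero_iff.1 h0)
  exact h (sub_eq_zero.1 hz ▸ ha)

theorem differentiable_multiset_prod_sub (s : Multiset ℂ) :
    Differentiable ℂ fun z => (s.map (z - ·)).prod := by
  induction s using Multiset.induction_on with
  | empty => simp
  | cons a s ih =>
    simp only [Multiset.map_cons, Multiset.prod_cons]
    fun_prop

/-- The argument principle for a function given together with its zeros. -/
theorem circleIntegral_logDeriv_multiset_prod_mul {c : ℂ} {R : ℝ} (hR : 0 ≤ R) {O : Set ℂ}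
    (hO : IsOpen O) (hb : Metric.closedBall c R ⊆ O) {g : ℂ → ℂ} (hg : DifferentiableOn ℂ g O)
    (hg0 : ∀ z ∈ Metric.closedBall c R, g z ≠ 0) {s : Multiset ℂ}
    (hs : ∀ a ∈ s, a ∈ Metric.ball c R) :
    (∮ z in C(c, R), logDeriv (fun z => (s.map (z - ·)).prod * g z) z) =
      s.card * (2 * Real.pi * Complex.I) := by
  induction s using Multiset.induction_on with
  | empty =>
    simp only [Multiset.map_zero, Multiset.prod_zero, one_mul, Multiset.card_zero, Nat.cast_zero,
      zero_mul]
    refine Complex.circleIntegral_eq_zero_of_differentiable_on_off_countable hR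
      Set.countable_empty ?_ fun z hz => ?_
    · exact ((hg.deriv hO).continuousOn.mono hb).div (hg.continuousOn.mono hb) hg0
    · have hz' := Metric.ball_subset_closedBall hz.1
      have hzO := hO.mem_nhds (hb hz')
      exact ((hg.deriv hO).differentiableAt hzO).div (hg.differentiableAt hzO) (hg0 z hz')
  | cons a s ih =>
    have ha := hs a (Multiset.mem_cons_self a s)
    have hs' : ∀ b ∈ s, b ∈ Metric.ball c R := fun b hb => hs b (Multiset.mem_cons_of_mem hb)
    have hsph : Metric.sphere c R ⊆ O := Metric.sphere_subset_closedBall.trans hb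
    have hne : ∀ z ∈ Metric.sphere c R, (s.map (z - ·)).prod * g z ≠ 0 := fun z hz =>
      mul_ne_zero (multiset_prod_sub_ne_zero fun h =>
        (Metric.sphere_disjoint_ball.le_bot ⟨hz, hs' z h⟩ : False))
        (hg0 z (Metric.sphere_subset_closedBall hz))
    have hza : ∀ z ∈ Metric.sphere c R, z - a ≠ 0 := fun z hz h =>
      (Metric.sphere_disjoint_ball.le_bot ⟨hz, (sub_eq_zero.1 h) ▸ ha⟩ : False)
    have hd : DifferentiableOn ℂ (fun z => (s.map (z - ·)).prod * g z) O :=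
      (differentiable_multiset_prod_sub s).differentiableOn.mul hg
    have hi : CircleIntegrable (fun z => (z - a)⁻¹) c R :=
      ContinuousOn.circleIntegrable hR (ContinuousOn.inv₀ (by fun_prop) hza)
    have hc : Set.EqOn (logDeriv fun z => ((a ::ₘ s).map (z - ·)).prod * g z)
        (fun z => (z - a)⁻¹ + logDeriv (fun z => (s.map (z - ·)).prod * g z) z)
        (Metric.sphere c R) := by
      intro z hz
      simp only [Multiset.map_cons, Multiset.prod_cons, mul_assoc]
      rw [logDeriv_mul z (hza z hz) (hne z hz) (by fun_prop)
        (hd.differentiableAt (hO.mem_nhds (hsph hz)))]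
      congr 1
      simp [logDeriv_apply]
    rw [circleIntegral.integral_congr hR hc, circleIntegral.integral_add hi
      (circleIntegrable_logDeriv hR hO hsph hd hne), ih hs',
      circleIntegral.integral_sub_inv_of_mem_ball ha, Multiset.card_cons]
    push_cast
    ring

/-- **Rouché's theorem** on a disk for functions given together with their zeros. -/
theorem rouche_card_eq {c : ℂ} {R : ℝ} (hR : 0 ≤ R) {O : Set ℂ}
    (hO : IsOpen O) (hb : Metric.closedBall c R ⊆ O) {g h : ℂ → ℂ} (hg : DifferentiableOn ℂ g O)
    (hh : DifferentiableOn ℂ h O) (hg0 : ∀ z ∈ Metric.closedBall c R, g z ≠ 0)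
    (hh0 : ∀ z ∈ Metric.closedBall c R, h z ≠ 0) {s t : Multiset ℂ}
    (hs : ∀ a ∈ s, a ∈ Metric.ball c R) (ht : ∀ a ∈ t, a ∈ Metric.ball c R)
    (hlt : ∀ z ∈ Metric.sphere c R, ‖(t.map (z - ·)).prod * h z - (s.map (z - ·)).prod * g z‖ <
      ‖(s.map (z - ·)).prod * g z‖) : s.card = t.card := by
  have hs1 := circleIntegral_logDeriv_multiset_prod_mul hR hO hb hg hg0 hs
  have ht1 := circleIntegral_logDeriv_multiset_prod_mul hR hO hb hh hh0 ht
  have hsph : Metric.sphere c R ⊆ O := Metric.sphere_subset_closedBall.trans hb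
  have hd : ∀ {s : Multiset ℂ} {g : ℂ → ℂ}, DifferentiableOn ℂ g O →
      DifferentiableOn ℂ (fun z => (s.map (z - ·)).prod * g z) O := fun hg =>
    (differentiable_multiset_prod_sub _).differentiableOn.mul hg
  have hsd := hd (s := s) hg
  have htd := hd (s := t) hh
  set p := fun z => (s.map (z - ·)).prod * g z
  set q := fun z => (t.map (z - ·)).prod * h z
  replace hlt : ∀ z ∈ Metric.sphere c R, ‖q z - p z‖ < ‖p z‖ := hlt
  have hp0 : ∀ z ∈ Metric.sphere c R, p z ≠ 0 := fun z hz =>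
    norm_pos_iff.1 ((norm_nonneg _).trans_lt (hlt z hz))
  have hq0 : ∀ z ∈ Metric.sphere c R, q z ≠ 0 := fun z hz h0 => by
    have := hlt z hz
    rw [h0, zero_sub, norm_neg] at this
    exact this.false
  -- On the circle `q / p` stays within distance 1 of 1, so the principal logarithm gives a
  -- primitive of its logarithmic derivative.
  have hzero : (∮ z in C(c, R), logDeriv (fun z => q z / p z) z) = 0 := by
    refine circleIntegral.integral_eq_zero_of_hasDerivWithinAt
      (f := fun z => Complex.log (q z / p z)) hR fun z hz => ?_
    have hzO := hO.mem_nhds (hsph hz)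
    have hslit : q z / p z ∈ Complex.slitPlane := by
      have : ‖q z / p z - 1‖ < 1 := by
        rw [div_sub_one (hp0 z hz), norm_div, div_lt_one (norm_pos_iff.2 (hp0 z hz))]
        exact hlt z hz
      simpa using Complex.mem_slitPlane_of_norm_lt_one this
    have hdiff : DifferentiableAt ℂ (fun z => q z / p z) z :=
      (htd.differentiableAt hzO).div (hsd.differentiableAt hzO) (hp0 z hz)
    exact (hdiff.hasDerivAt.clog hslit).hasDerivWithinAt
  have hc : Set.EqOn (logDeriv fun z => q z / p z) (fun z => logDeriv q z - logDeriv p z)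
      (Metric.sphere c R) := fun z hz =>
    logDeriv_div z (hq0 z hz) (hp0 z hz) (htd.differentiableAt (hO.mem_nhds (hsph hz)))
      (hsd.differentiableAt (hO.mem_nhds (hsph hz)))
  rw [circleIntegral.integral_congr hR hc, circleIntegral.integral_sub
    (circleIntegrable_logDeriv hR hO hsph htd hq0) (circleIntegrable_logDeriv hR hO hsph hsd hp0),
    hs1, ht1, sub_eq_zero] at hzero
  exact_mod_cast (mul_right_cancel₀ Complex.two_pi_I_ne_zero hzero).symm

/-! ### Counting polynomial roots in sets. -/

theorem countIn_mono (s : Multiset ℂ) {A B : Set ℂ} (h : A ⊆ B) : countIn s A ≤ countIn s B := by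
  classical
  exact Multiset.card_le_card (Multiset.monotone_filter_right s fun _ ha => h ha)

theorem countIn_union_of_disjoint (s : Multiset ℂ) {A B : Set ℂ} (h : Disjoint A B) :
    countIn s (A ∪ B) = countIn s A + countIn s B := by
  classical
  unfold countIn
  rw [← Multiset.card_add, Multiset.filter_add_filter]
  have : s.filter (fun a => a ∈ A ∧ a ∈ B) = 0 :=
    Multiset.filter_eq_nil.2 fun a _ hab => h.le_bot hab
  simp only [this, add_zero, Set.mem_union]

theorem countIn_biUnion_of_pairwiseDisjoint (s : Multiset ℂ) (Z : Finset ℂ) (B : ℂ → Set ℂ)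
    (h : (Z : Set ℂ).PairwiseDisjoint B) :
    countIn s (⋃ z ∈ Z, B z) = ∑ z ∈ Z, countIn s (B z) := by
  classical
  induction Z using Finset.induction_on with
  | empty => simp [countIn]
  | insert a Z ha ih =>
    rw [Finset.set_biUnion_insert, Finset.sum_insert ha, countIn_union_of_disjoint, ih]
    · exact h.subset (by simp)
    · rw [Set.disjoint_iUnion₂_right]
      intro z hz
      exact h (by simp) (by simp [hz]) fun e => ha (e ▸ hz)

theorem countIn_le_of_forall_mem (s : Multiset ℂ) {A B : Set ℂ} (h : ∀ a ∈ s, a ∈ A → a ∈ B) :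
    countIn s A ≤ countIn s B := by
  classical
  unfold countIn
  refine Multiset.card_le_card (Multiset.le_filter.2 ⟨Multiset.filter_le _ _, fun a ha => ?_⟩)
  rw [Multiset.mem_filter] at ha
  exact h a ha.1 ha.2

/-- Splitting the linear factors by whether their root lies in `S` brings `p` into the factored form
that `rouche_card_eq` takes; `h` collects the other factors and the leading coefficient. -/
theorem exists_eval_eq_multiset_prod_mul (p : ℂ[X]) (hp : p ≠ 0) (S : Set ℂ) :
    ∃ (s : Multiset ℂ) (h : ℂ → ℂ), s.card = countIn p.roots S ∧ (∀ a ∈ s, a ∈ S) ∧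
      Differentiable ℂ h ∧ (∀ z, p.eval z = (s.map (z - ·)).prod * h z) ∧
      ∀ z, h z = 0 → p.eval z = 0 ∧ z ∉ S := by
  classical
  refine ⟨p.roots.filter (· ∈ S),
    fun z => ((p.roots.filter (· ∉ S)).map (z - ·)).prod * p.leadingCoeff, ?_,
    fun a ha => (Multiset.mem_filter.1 ha).2, ?_, fun z => ?_, fun z hz => ?_⟩
  · unfold countIn
    congr!
  · exact (differentiable_multiset_prod_sub _).mul_const _
  · rw [← mul_assoc, ← Multiset.prod_add, ← Multiset.map_add, Multiset.filter_add_not]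
    conv_lhs => rw [(IsAlgClosed.splits p).eq_prod_roots]
    rw [eval_mul, eval_C, eval_multiset_prod, Multiset.map_map, mul_comm]
    simp
  · have h1 := (mul_eq_zero.1 hz).resolve_right (leadingCoeff_ne_zero.2 hp)
    have h2 : z ∈ p.roots.filter (· ∉ S) := by
      by_contra hn
      exact multiset_prod_sub_ne_zero hn h1
    rw [Multiset.mem_filter, mem_roots hp] at h2
    exact h2

/-- In the closed ball the cofactors could vanish only on the sphere, where the strict inequality
excludes zeros of both polynomials. -/
theorem countIn_roots_ball_eq_of_norm_sub_lt {p q : ℂ[X]} (hp : p ≠ 0) (hq : q ≠ 0) {c : ℂ} {R : ℝ}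
    (hR : 0 ≤ R) (h : ∀ z ∈ Metric.sphere c R, ‖q.eval z - p.eval z‖ < ‖p.eval z‖) :
    countIn p.roots (Metric.ball c R) = countIn q.roots (Metric.ball c R) := by
  obtain ⟨s, g, hs, hsb, hg, hgp, hg0⟩ := exists_eval_eq_multiset_prod_mul p hp (Metric.ball c R)
  obtain ⟨t, k, ht, htb, hk, hkq, hk0⟩ := exists_eval_eq_multiset_prod_mul q hq (Metric.ball c R)
  have hsph : ∀ z ∈ Metric.closedBall c R, z ∉ Metric.ball c R → z ∈ Metric.sphere c R :=
    fun z hz hz' => le_antisymm hz (not_lt.1 hz')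
  rw [← hs, ← ht]
  refine rouche_card_eq hR isOpen_univ (Set.subset_univ (Metric.closedBall c R)) hg.differentiableOn
    hk.differentiableOn (fun z hz h0 => ?_) (fun z hz h0 => ?_) hsb htb fun z hz => ?_
  · have := h z (hsph z hz (hg0 z h0).2)
    rw [(hg0 z h0).1, norm_zero] at this
    exact (norm_nonneg _).not_gt this
  · have := h z (hsph z hz (hk0 z h0).2)
    rw [(hk0 z h0).1, zero_sub, norm_neg] at this
    exact this.false
  · rw [← hgp, ← hkq]
    exact h z hz

/-! ### Hurwitz's theorem for polynomials that agree with `d n` up to a zero-free factor. -/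

section Hurwitz

variable {Ω : Set ℂ} {D : ℂ → ℂ} {d : ℕ → ℂ → ℂ}

/-- By compactness `‖D‖` has a positive lower bound on `K`. The inequality serves both as Rouché's
hypothesis on spheres and as a proof that `d n` has no zeros in `K`. -/
theorem eventually_norm_sub_lt_norm (hD : ContinuousOn D Ω)
    (hlim : ∀ K ⊆ Ω, IsCompact K → TendstoUniformlyOn d D atTop K) {K : Set ℂ} (hK : K ⊆ Ω)
    (hKc : IsCompact K) (h0 : ∀ z ∈ K, D z ≠ 0) :
    ∀ᶠ n in atTop, ∀ z ∈ K, ‖d n z - D z‖ < ‖D z‖ := by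
  obtain ⟨m, hm, hmK⟩ := hKc.exists_forall_le' (hD.mono hK).norm
    fun z hz => norm_pos_iff.2 (h0 z hz)
  filter_upwards [Metric.tendstoUniformlyOn_iff.1 (hlim K hK hKc) m hm] with n hn z hz
  rw [← dist_eq_norm, dist_comm]
  exact (hn z hz).trans_le (hmK z hz)

variable {p : ℕ → ℂ[X]} (hΩ : IsOpen Ω) (hD : DifferentiableOn ℂ D Ω)
  (hlim : ∀ K ⊆ Ω, IsCompact K → TendstoUniformlyOn d D atTop K) (hp0 : ∀ n, p n ≠ 0)
  (hp : ∀ᶠ n in atTop, ∃ u : ℂ → ℂ, DifferentiableOn ℂ u Ω ∧ (∀ z ∈ Ω, u z ≠ 0) ∧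
    ∀ z ∈ Ω, (p n).eval z = u z * d n z)

include hΩ hD hlim hp0 hp

/-- **Hurwitz's theorem**: near a zero of the limit the number of zeros is the multiplicity. -/
theorem eventually_countIn_roots_ball_eq {z₀ : ℂ} (hz₀ : z₀ ∈ Ω) (htop : analyticOrderAt D z₀ ≠ ⊤) :
    ∀ᶠ δ in 𝓝[>] (0 : ℝ), ∀ᶠ n in atTop,
      countIn (p n).roots (Metric.ball z₀ δ) = analyticOrderNatAt D z₀ := by
  have han : AnalyticAt ℂ D z₀ := hD.analyticAt (hΩ.mem_nhds hz₀)
  obtain ⟨g, hg, hg0, hgD⟩ := han.analyticOrderAt_ne_top.1 htop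
  have hev : ∀ᶠ z in 𝓝 z₀, z ∈ Ω ∧ DifferentiableAt ℂ g z ∧ g z ≠ 0 ∧
      D z = (z - z₀) ^ analyticOrderNatAt D z₀ • g z := by
    filter_upwards [hΩ.mem_nhds hz₀, hg.eventually_analyticAt, hg.continuousAt.eventually_ne hg0,
      hgD] with z h1 h2 h3 h4
    exact ⟨h1, h2.differentiableAt, h3, h4⟩
  obtain ⟨ε, hε, hball⟩ := Metric.eventually_nhds_iff_ball.1 hev
  filter_upwards [Ioo_mem_nhdsGT hε] with δ hδ
  have hcb : Metric.closedBall z₀ δ ⊆ Metric.ball z₀ ε := Metric.closedBall_subset_ball hδ.2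
  have hsph : Metric.sphere z₀ δ ⊆ Ω := fun z hz =>
    (hball z (hcb (Metric.sphere_subset_closedBall hz))).1
  have hD0 : ∀ z ∈ Metric.sphere z₀ δ, D z ≠ 0 := fun z hz => by
    obtain ⟨-, -, h3, h4⟩ := hball z (hcb (Metric.sphere_subset_closedBall hz))
    rw [h4]
    exact smul_ne_zero (pow_ne_zero _ (sub_ne_zero.2 (Metric.ne_of_mem_sphere hz hδ.1.ne'))) h3
  filter_upwards [hp, eventually_norm_sub_lt_norm hD.continuousOn hlim hsph
    (isCompact_sphere z₀ δ) hD0] with n ⟨u, hu, hu0, hup⟩ hn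
  obtain ⟨t, k, ht, htb, hk, hkp, hk0⟩ :=
    exists_eval_eq_multiset_prod_mul (p n) (hp0 n) (Metric.ball z₀ δ)
  -- Only `d n`, not `p n`, is close to `D`; dividing out `u` keeps the zeros and lets Rouché's
  -- theorem compare `d n` with `D = (z - z₀)^k g`, where `k` is the order of the zero.
  have hd : ∀ z ∈ Ω, d n z = (t.map (z - ·)).prod * (k z / u z) := fun z hz => by
    rw [← mul_div_assoc, ← hkp, hup z hz, mul_div_cancel_left₀ _ (hu0 z hz)]
  have hsub : Metric.ball z₀ ε ⊆ Ω := fun z hz => (hball z hz).1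
  rw [← ht, ← Multiset.card_replicate (analyticOrderNatAt D z₀) z₀]
  symm
  refine rouche_card_eq (g := g) (h := fun z => k z / u z) hδ.1.le Metric.isOpen_ball hcb
    (fun z hz => (hball z hz).2.1.differentiableWithinAt)
    (hk.differentiableOn.div (hu.mono hsub) fun z hz => hu0 z (hsub hz))
    (fun z hz => (hball z (hcb hz)).2.2.1) (fun z hz h0 => ?_)
    (fun a ha => ?_) htb fun z hz => ?_
  · obtain ⟨h1, h2⟩ := hk0 z ((div_eq_zero_iff.1 h0).resolve_right (hu0 z (hsub (hcb hz))))
    have hz' : z ∈ Metric.sphere z₀ δ := le_antisymm hz (not_lt.1 h2)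
    have h3 : d n z = 0 := by
      rw [hup z (hsph hz')] at h1
      exact (mul_eq_zero.1 h1).resolve_left (hu0 z (hsph hz'))
    have := hn z hz'
    rw [h3, zero_sub, norm_neg] at this
    exact this.false
  · rw [Multiset.eq_of_mem_replicate ha]
    exact Metric.mem_ball_self hδ.1
  · have h4 := (hball z (hcb (Metric.sphere_subset_closedBall hz))).2.2.2
    rw [smul_eq_mul] at h4
    rw [← hd z (hsph hz), Multiset.map_replicate, Multiset.prod_replicate, ← h4]
    exact hn z hz

/-- Balls of one small common radius about the points of `Z` are disjoint and lie in `W`, so the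
local counts add up. Both the lower and the upper bound on root counts come from this `B`. -/
theorem exists_isOpen_eventually_countIn_roots_eq_sum (htop : ∀ z ∈ Ω, analyticOrderAt D z ≠ ⊤)
    {Z : Finset ℂ} {W : Set ℂ} (hW : IsOpen W) (hZW : ↑Z ⊆ W) (hWΩ : W ⊆ Ω) :
    ∃ B ⊆ W, IsOpen B ∧ ↑Z ⊆ B ∧
      ∀ᶠ n in atTop, countIn (p n).roots B = ∑ z ∈ Z, analyticOrderNatAt D z := by
  have h1 : ∀ᶠ δ in 𝓝[>] (0 : ℝ), ∀ z ∈ Z, Metric.ball z δ ⊆ W ∧ ∀ᶠ n in atTop,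
      countIn (p n).roots (Metric.ball z δ) = analyticOrderNatAt D z := by
    rw [eventually_all_finset]
    intro z hz
    refine Eventually.and ?_ (eventually_countIn_roots_ball_eq hΩ hD hlim hp0 hp
      (hWΩ (hZW hz)) (htop z (hWΩ (hZW hz))))
    obtain ⟨ε, hε, hb⟩ := Metric.isOpen_iff.1 hW z (hZW hz)
    filter_upwards [Ioo_mem_nhdsGT hε] with δ hδ
    exact (Metric.ball_subset_ball hδ.2.le).trans hb
  have h2 : ∀ᶠ δ in 𝓝[>] (0 : ℝ), ∀ z ∈ Z, ∀ w ∈ Z, z ≠ w → δ + δ ≤ dist z w := by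
    simp only [eventually_all_finset, eventually_imp_distrib_left]
    intro z _ w _ hzw
    filter_upwards [Ioo_mem_nhdsGT (half_pos (dist_pos.2 hzw))] with δ hδ
    linarith [hδ.2]
  obtain ⟨δ, h1, h2, hδ⟩ := (h1.and (h2.and self_mem_nhdsWithin)).exists
  refine ⟨⋃ z ∈ Z, Metric.ball z δ, Set.iUnion₂_subset fun z hz => (h1 z hz).1,
    isOpen_biUnion fun _ _ => Metric.isOpen_ball,
    fun z hz => Set.mem_biUnion hz (Metric.mem_ball_self hδ), ?_⟩
  filter_upwards [(eventually_all_finset Z).2 fun z hz => (h1 z hz).2] with n hn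
  rw [countIn_biUnion_of_pairwiseDisjoint, Finset.sum_congr rfl hn]
  exact fun z hz w hw hzw => Metric.ball_disjoint_ball (h2 z hz w hw hzw)

theorem eventually_sum_le_countIn_roots (htop : ∀ z ∈ Ω, analyticOrderAt D z ≠ ⊤)
    {Z : Finset ℂ} {W : Set ℂ} (hW : IsOpen W) (hZW : ↑Z ⊆ W) (hWΩ : W ⊆ Ω) :
    ∀ᶠ n in atTop, ∑ z ∈ Z, analyticOrderNatAt D z ≤ countIn (p n).roots W := by
  obtain ⟨B, hBW, -, -, hB⟩ :=
    exists_isOpen_eventually_countIn_roots_eq_sum hΩ hD hlim hp0 hp htop hW hZW hWΩ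
  filter_upwards [hB] with n hn
  exact hn ▸ countIn_mono _ hBW

/-- On the compact set `K \ B` the limit has no zeros, so eventually neither has `p n`: all its
roots in `K` lie in the small balls `B`. -/
theorem eventually_countIn_roots_le_sum (htop : ∀ z ∈ Ω, analyticOrderAt D z ≠ ⊤)
    {Z : Finset ℂ} (hZ : ↑Z ⊆ Ω) {K : Set ℂ} (hKc : IsCompact K) (hK : K ⊆ Ω)
    (h0 : ∀ z ∈ K, D z = 0 → z ∈ Z) :
    ∀ᶠ n in atTop, countIn (p n).roots K ≤ ∑ z ∈ Z, analyticOrderNatAt D z := by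
  obtain ⟨B, -, hBo, hZB, hB⟩ :=
    exists_isOpen_eventually_countIn_roots_eq_sum hΩ hD hlim hp0 hp htop hΩ hZ subset_rfl
  have hKB : K \ B ⊆ Ω := Set.sdiff_subset.trans hK
  filter_upwards [hB, hp, eventually_norm_sub_lt_norm hD.continuousOn hlim hKB (hKc.diff hBo)
    fun z hz hz0 => hz.2 (hZB (h0 z hz.1 hz0))] with n hn ⟨u, _, hu0, hup⟩ hn'
  rw [← hn]
  refine countIn_le_of_forall_mem _ fun a ha haK => ?_
  by_contra haB
  have h1 : (p n).eval a = 0 := (mem_roots (hp0 n)).1 ha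
  rw [hup a (hK haK)] at h1
  have := hn' a ⟨haK, haB⟩
  rw [(mul_eq_zero.1 h1).resolve_left (hu0 a (hK haK)), zero_sub, norm_neg] at this
  exact this.false

end Hurwitz

/-! ### Zeros of `Φ_n^*` in the whole disk, and the poles of `F`. -/

theorem isOpen_unitDisk : IsOpen unitDisk := Metric.isOpen_ball

/-- On the unit circle `Φ_{n+1}^* - Φ_n^*` has modulus `|α n| |Φ_n| = |α n| |Φ_n^*| < |Φ_n^*|`, so
Rouché's theorem applies. This gives the uniform bound behind the finiteness of the poles. -/
theorem countIn_roots_szegoPhiStar_unitDisk {α : ℕ → ℂ} {N : ℕ} (hne : ∀ n < N, ‖α n‖ ≠ 1)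
    (hlt : ∀ n, N ≤ n → ‖α n‖ < 1) {n : ℕ} (hn : N ≤ n) :
    countIn (szegoPhiStar α n).roots unitDisk = countIn (szegoPhiStar α N).roots unitDisk := by
  induction n, hn using Nat.le_induction with
  | base => rfl
  | succ n hn ih =>
    rw [← ih]
    symm
    refine countIn_roots_ball_eq_of_norm_sub_lt (szegoPhiStar_ne_zero α n)
      (szegoPhiStar_ne_zero α (n + 1)) zero_le_one fun z hz => ?_
    have hz1 : ‖z‖ = 1 := mem_sphere_zero_iff_norm.1 hz
    have h0 : (szegoPhiStar α n).eval z ≠ 0 :=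
      eval_szegoPhiStar_ne_zero_of_norm_eq_one n (fun k _ => (lt_or_ge k N).elim (hne k)
        fun hk => (hlt k hk).ne) hz1
    rw [eval_szegoPhiStar_succ, sub_sub_cancel_left, norm_neg, norm_mul, norm_mul, hz1, one_mul,
      ← norm_eval_szegoPhiStar_of_norm_eq_one α n hz1]
    exact mul_lt_of_lt_one_left (norm_pos_iff.2 h0) (hlt n hn)

theorem poleMultiplicity_div {A D : ℂ → ℂ} {z : ℂ} (hA : AnalyticAt ℂ A z) (hD : AnalyticAt ℂ D z)
    (htop : analyticOrderAt D z ≠ ⊤) (h0 : D z = 0 → A z ≠ 0) :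
    poleMultiplicity (fun w => A w / D w) z = analyticOrderNatAt D z := by
  unfold poleMultiplicity
  by_cases hDz : D z = 0
  · have h1 : meromorphicOrderAt A z = 0 := by
      rw [hA.meromorphicOrderAt_eq, hA.analyticOrderAt_eq_zero.2 (h0 hDz)]
      rfl
    have h2 : meromorphicOrderAt D z = ((analyticOrderNatAt D z : ℤ) : WithTop ℤ) := by
      rw [hD.meromorphicOrderAt_eq, ← Nat.cast_analyticOrderNatAt htop]
      rfl
    have h3 := fun_meromorphicOrderAt_div hA.meromorphicAt hD.meromorphicAt
    rw [h3, h1, h2, zero_sub]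
    rw [WithTop.untop₀_neg, WithTop.untop₀_coe]
    simp
  -- Here the quotient is analytic, its order is nonnegative, and `toNat` truncates the negated
  -- order to 0.
  · have h1 := (hA.fun_div hD hDz).meromorphicOrderAt_nonneg
    have h2 : 0 ≤ (meromorphicOrderAt (fun w => A w / D w) z).untop₀ := WithTop.untop₀_nonneg.2 h1
    rw [Int.toNat_of_nonpos (by omega), analyticOrderNatAt, hD.analyticOrderAt_eq_zero.2 hDz]
    rfl

theorem poleMultiplicity_pseudoCaratheodory {α : ℕ → ℂ} {N : ℕ} (hne : ∀ n < N, ‖α n‖ ≠ 1)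
    (hlt : ∀ n, N ≤ n → ‖α n‖ < 1) {z : ℂ} (hz : z ∈ unitDisk)
    (htop : analyticOrderAt (szegoDenom α N (schurFunction fun k => α (N + k))) z ≠ ⊤) :
    poleMultiplicity (pseudoCaratheodory α N) z =
      analyticOrderNatAt (szegoDenom α N (schurFunction fun k => α (N + k))) z := by
  have hf := (schurFunction_isSchurFunction fun k => hlt (N + k) (by omega)).1
  have hD := szegoDenom_differentiableOn α N hf
  have hz' := isOpen_unitDisk.mem_nhds hz
  refine poleMultiplicity_div (A := fun z => (szegoPsiStar α N).eval z
      + z * (szegoPsi α N).eval z * schurFunction (fun k => α (N + k)) z)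
    (DifferentiableOn.analyticAt (s := unitDisk) (by fun_prop) hz') (hD.analyticAt hz') htop
    (fun h0 hA => ?_)
  change (szegoPhiStar α N).eval z - z * (szegoPhi α N).eval z * _ = 0 at h0
  have hz0 : z ≠ 0 := by
    rintro rfl
    rw [eval_szegoPhiStar_at_zero, zero_mul, zero_mul, sub_zero] at h0
    exact one_ne_zero h0
  have hw := szego_wronskian α N z
  refine mul_ne_zero (mul_ne_zero two_ne_zero (pow_ne_zero N hz0)) (szego_prod_ne_zero N hne) ?_
  -- `Ψ_N` times the denominator plus `Φ_N` times the numerator eliminates `f_N` and leaves the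
  -- Wronskian.
  linear_combination (szegoPsi α N).eval z * h0 + (szegoPhi α N).eval z * hA - hw

/-! ### Finiteness of the poles and the final counts. -/

theorem finite_of_forall_finset_card_le {β : Type*} {S : Set β} (k : ℕ)
    (h : ∀ Z : Finset β, ↑Z ⊆ S → Z.card ≤ k) : S.Finite := by
  by_contra hS
  obtain ⟨Z, hZ, hc⟩ := Set.Infinite.exists_subset_card_eq hS (k + 1)
  have := h Z hZ
  omega

open Classical in
theorem countIn_sum_replicate (Z : Finset ℂ) (f : ℂ → ℕ) (S : Set ℂ) :
    countIn (∑ z ∈ Z, Multiset.replicate (f z) z) S = ∑ z ∈ Z with z ∈ S, f z := by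
  induction Z using Finset.induction_on with
  | empty => simp [countIn]
  | insert a Z ha ih =>
    rw [Finset.sum_insert ha, Finset.filter_insert]
    have h1 : countIn (Multiset.replicate (f a) a + ∑ z ∈ Z, Multiset.replicate (f z) z) S =
        countIn (Multiset.replicate (f a) a) S +
          countIn (∑ z ∈ Z, Multiset.replicate (f z) z) S := by
      simp [countIn]
    rw [h1, ih]
    by_cases haS : a ∈ S
    · rw [if_pos haS, Finset.sum_insert (by simp [ha]), countIn, Multiset.filter_eq_self.2,
        Multiset.card_replicate]
      intro b hb
      rwa [Multiset.eq_of_mem_replicate hb]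
    · rw [if_neg haS, countIn, Multiset.filter_eq_nil.2, Multiset.card_zero, zero_add]
      intro b hb
      rwa [Multiset.eq_of_mem_replicate hb]

theorem lemma1 (α : ℕ → ℂ) (N : ℕ)
    (hne : ∀ n < N, ‖α n‖ ≠ 1) (hlt : ∀ n, N ≤ n → ‖α n‖ < 1) :
    ∃ poles : Multiset ℂ,
      IsPoleMultiset (pseudoCaratheodory α N) unitDisk poles ∧
      (∀ U K : Set ℂ, IsOpen U → IsCompact K → U ⊆ K → K ⊆ unitDisk →
        (∀ᶠ n in atTop, countIn poles U ≤ countIn (szegoPhiStar α n).roots U) ∧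
        ((∀ z ∈ poles, z ∉ frontier U) →
          ∀ᶠ n in atTop, countIn (szegoPhiStar α n).roots U = countIn poles U)) ∧
      (∀ K : Set ℂ, IsCompact K → K ⊆ unitDisk →
        ∀ᶠ n in atTop, countIn (szegoPhiStar α n).roots K ≤ poles.card) := by
  classical
  have hγ : ∀ k, ‖α (N + k)‖ < 1 := fun k => hlt _ (by omega)
  set D := szegoDenom α N (schurFunction fun k => α (N + k)) with hDdef
  have hD : DifferentiableOn ℂ D unitDisk :=
    szegoDenom_differentiableOn α N (schurFunction_isSchurFunction hγ).1
  have hDan : AnalyticOnNhd ℂ D unitDisk := hD.analyticOnNhd isOpen_unitDisk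
  have h0mem : (0 : ℂ) ∈ unitDisk := Metric.mem_ball_self one_pos
  -- Since `D 0 = 1`, the identity theorem excludes zeros of infinite order.
  have htop : ∀ z ∈ unitDisk, analyticOrderAt D z ≠ ⊤ := fun z hz => by
    refine hDan.analyticOrderAt_ne_top_of_isPreconnected
      (convex_ball (0 : ℂ) 1).isPreconnected h0mem hz ?_
    rw [(hDan 0 h0mem).analyticOrderAt_eq_zero.2 (by rw [hDdef, szegoDenom_zero]; exact one_ne_zero)]
    exact ENat.zero_ne_top
  set d : ℕ → ℂ → ℂ := fun n => szegoDenom α N (schurApprox (n - N) fun k => α (N + k))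
  have hlim : ∀ K ⊆ unitDisk, IsCompact K → TendstoUniformlyOn d D atTop K := fun K hK hKc u hu =>
    (tendsto_sub_atTop_nat N).eventually (tendstoUniformlyOn_szegoDenom hlt hKc hK u hu)
  have hp0 := szegoPhiStar_ne_zero α
  have hp : ∀ᶠ n in atTop, ∃ u : ℂ → ℂ, DifferentiableOn ℂ u unitDisk ∧
      (∀ z ∈ unitDisk, u z ≠ 0) ∧ ∀ z ∈ unitDisk, (szegoPhiStar α n).eval z = u z * d n z := by
    filter_upwards [eventually_ge_atTop N] with n hn
    obtain ⟨u, hu, hu0, hup⟩ := szegoPhiStar_eq_mul_szegoDenom (n - N) hlt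
    rw [Nat.add_sub_cancel' hn] at hup
    exact ⟨u, hu, hu0, hup⟩
  have hpos : ∀ z ∈ unitDisk, D z = 0 → 1 ≤ analyticOrderNatAt D z := fun z hz h0 => by
    rw [Nat.one_le_iff_ne_zero]
    intro h
    have h1 := Nat.cast_analyticOrderNatAt (htop z hz)
    rw [h] at h1
    exact (hDan z hz).analyticOrderAt_eq_zero.1 (by exact_mod_cast h1.symm) h0
  -- Any finite set of zeros of `D` is matched, for some large `n`, by at least as many zeros of
  -- `Φ_n^*` in the disk, and their number is that of `Φ_N^*`.
  have hfin : {z ∈ unitDisk | D z = 0}.Finite := by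
    refine finite_of_forall_finset_card_le (countIn (szegoPhiStar α N).roots unitDisk)
      fun Z hZ => ?_
    obtain ⟨n, h1, h2⟩ := ((eventually_sum_le_countIn_roots isOpen_unitDisk hD hlim hp0 hp htop
      isOpen_unitDisk (hZ.trans (Set.sep_subset _ _)) subset_rfl).and (eventually_ge_atTop N)).exists
    rw [countIn_roots_szegoPhiStar_unitDisk hne hlt h2] at h1
    refine le_trans ?_ h1
    rw [Finset.card_eq_sum_ones]
    exact Finset.sum_le_sum fun z hz => hpos z (hZ hz).1 (hZ hz).2
  set Z := hfin.toFinset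
  have hZ : ∀ {z}, z ∈ Z ↔ z ∈ unitDisk ∧ D z = 0 := fun {z} => hfin.mem_toFinset
  set poles := ∑ z ∈ Z, Multiset.replicate (analyticOrderNatAt D z) z with hpoles
  have hcount : ∀ S : Set ℂ, countIn poles S = ∑ z ∈ Z with z ∈ S, analyticOrderNatAt D z :=
    fun S => countIn_sum_replicate Z _ S
  have hmem : ∀ z, z ∈ poles → z ∈ Z := fun z hz => by
    obtain ⟨w, hw, hzw⟩ := Multiset.mem_sum.1 hz
    rwa [Multiset.eq_of_mem_replicate hzw]
  have hmem' : ∀ z ∈ Z, z ∈ poles := fun z hz =>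
    Multiset.mem_sum.2 ⟨z, hz, Multiset.mem_replicate.2
      ⟨Nat.one_le_iff_ne_zero.1 (hpos z (hZ.1 hz).1 (hZ.1 hz).2), rfl⟩⟩
  have hupper : ∀ K ⊆ unitDisk, IsCompact K → ∀ᶠ n in atTop,
      countIn (szegoPhiStar α n).roots K ≤ countIn poles K := fun K hK hKc => by
    rw [hcount]
    exact eventually_countIn_roots_le_sum isOpen_unitDisk hD hlim hp0 hp htop
      (fun z hz => (hZ.1 (Finset.mem_filter.1 hz).1).1) hKc hK
      fun z hz h0 => Finset.mem_filter.2 ⟨hZ.2 ⟨hK hz, h0⟩, hz⟩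
  have hlower : ∀ U ⊆ unitDisk, IsOpen U → ∀ᶠ n in atTop,
      countIn poles U ≤ countIn (szegoPhiStar α n).roots U := fun U hU hUo => by
    rw [hcount]
    exact eventually_sum_le_countIn_roots isOpen_unitDisk hD hlim hp0 hp htop hUo
      (fun z hz => (Finset.mem_filter.1 hz).2) hU
  refine ⟨poles, ⟨fun z hz => ?_, fun z hz => (hZ.1 (hmem z hz)).1⟩,
    fun U K hUo hKc hUK hK => ⟨hlower U (hUK.trans hK) hUo, fun hfr => ?_⟩, fun K hKc hK => ?_⟩
  · rw [poleMultiplicity_pseudoCaratheodory hne hlt hz (htop z hz), hpoles, Multiset.count_sum']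
    simp only [Multiset.count_replicate]
    rw [Finset.sum_ite_eq' Z z, ite_eq_left_iff]
    intro hzZ
    rw [analyticOrderNatAt, (hDan z hz).analyticOrderAt_eq_zero.2 fun h0 => hzZ (hZ.2 ⟨hz, h0⟩)]
    rfl
  -- The upper bound needs a compact set, so it is applied to `closure U`; with no pole on the
  -- frontier, `closure U` contains no more poles than `U`.
  · have hcl : closure U ⊆ K := hKc.isClosed.closure_subset_iff.2 hUK
    filter_upwards [hlower U (hUK.trans hK) hUo,
      hupper (closure U) (hcl.trans hK) (hKc.of_isClosed_subset isClosed_closure hcl)] with n h1 h2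
    refine le_antisymm ((countIn_mono _ subset_closure).trans (h2.trans ?_)) h1
    refine countIn_le_of_forall_mem _ fun z hz hzU => ?_
    by_contra hzn
    exact hfr z hz ⟨hzU, fun hi => hzn (interior_subset hi)⟩
  · filter_upwards [hupper K hK hKc] with n hn
    exact hn.trans (Multiset.card_le_card (Multiset.filter_le _ _))
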